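/- Let $s\ge 2$ be an integer, $\vartheta>1$ and $b_1,b_2>0$. Let $\mathbb T^+=\{e^{2\pi i\alpha}:\alpha\in(0,\tfrac12)\}$, let $\|x\|_{\mathbb R/\mathbb Z}=\mathrm{dist}(x,\mathbb Z)$ for $x\in\mathbb R$, and let $\|\cdot\|_\infty$ be the sup-norm on $\mathbb C^{2s}$. Let $H=H(s,\vartheta,b_1,b_2)$ be the set of all $\boldsymbol\theta=(\theta_1,\dots,\theta_{2s})\in\mathbb C^{2s}$ such that $|\theta_{2j-1}|=\vartheta$, $\mathrm{Im}(\theta_{2j-1})\ge b_1$ and $\theta_{2j}=\overline{\theta_{2j-1}}$ for $j=1,\dots,s$, and $|\theta_i-\theta_j|\ge b_2$ for all $i\ne j$ in $\{1,\dots,2s\}$. For $\boldsymbol\theta\in H$, $\varepsilon>0$ and $\mathbf z\in\mathbb C^{2s}$ with $z_{2j}=\overline{z_{2j-1}}$ $(1\le j\le s)$ and $\|\mathbf z\|_\infty\ge1$, let $N(\mathbf z)$ be the integer $N\ge 0$ with $\vartheta^{-N}\|\mathbf z\|_\infty\in[1,\vartheta)$, let $\tau_j=\theta_j^{-N(\mathbf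 z)}z_j$ for $1\le j\le 2s$, and let $$\Psi(\boldsymbol\theta,\varepsilon,\mathbf z)=\prod_{n=0}^{N(\mathbf z)}\Bigl(1-2\pi\varepsilon\,\Bigl\|\sum_{j=1}^{2s}\theta_j^n\tau_j\Bigr\|_{\mathbb R/\mathbb Z}^2\Bigr)$$ (the sum is a real number). There is a constant $C_H>0$, depending only on $s,\vartheta,b_1,b_2$, such that for every $\ell\in\{1,\dots,s\}$ and all $\beta,\varepsilon>0$ there is $\gamma_\ell>0$, depending only on $s,\vartheta,b_1,b_2,\ell,\beta,\varepsilon$, with the following property. Fix numbers $\theta'_j\in\mathbb C$ for $j\in\{1,\dots,2s\}\setminus\{2\ell-1,2\ell\}$ that are the corresponding coordinates of some element of $H$. Then there is a set $\mathcal E_\ell\subset\vartheta\cdot\mathbb T^+\subset\mathbb C$ such that (i) $\dim_{\rm H}(\mathcal E_\ell)\le\beta$; (ii) for every $\boldsymbol\theta\in H$ with $\theta_j=\theta'_j$ for all $j\notin\{2\ell-1,2\ell\}$ and $\theta_{2\ell-1}\in\vartheta\cdot\mathbb T^+\setminus\mathcal E_\ell$, there is a constant $R\ge 1$ (which may depend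 on $\boldsymbol\theta$ and on the data fixed above) such that, for every probability vector $\boldsymbol p=(p_0,\dots,p_m)$ with $\min_i p_i\ge\varepsilon$, $$\Psi(\boldsymbol\theta,\varepsilon,\mathbf z)\le C_H\,\|\mathbf z\|_\infty^{-\gamma_\ell}$$ for all $\mathbf z\in\mathbb C^{2s}$ with $z_{2j}=\overline{z_{2j-1}}$ $(1\le j\le s)$ and $|z_{2\ell-1}|=\|\mathbf z\|_\infty\ge R$. -/

import Mathlib

noncomputable section

namespace FourierDecay

/-- The position of the coordinate `2j-1` of a vector `(x_1, …, x_{2s})`, where `j ∈ {1, …, s}`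
is represented by an element of `Fin s` (so both indices are shifted by one). -/
def oddIdx {s : ℕ} (j : Fin s) : Fin (2 * s) := ⟨2 * j.1, by omega⟩

/-- The position of the coordinate `2j` of a vector `(x_1, …, x_{2s})`. -/
def evenIdx {s : ℕ} (j : Fin s) : Fin (2 * s) := ⟨2 * j.1 + 1, by omega⟩

/-- `x_{2j}` is the complex conjugate of `x_{2j-1}` for all `j`; that is, `x = x(ζ)` is the vector
`(ζ_1, conj ζ_1, …, ζ_s, conj ζ_s)` of some `ζ ∈ ℂ^s`. -/
def ConjPaired {s : ℕ} (x : Fin (2 * s) → ℂ) : Prop :=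
  ∀ j : Fin s, x (evenIdx j) = (starRingEnd ℂ) (x (oddIdx j))

/-- The separated set `H(s, ϑ, b₁, b₂) ⊆ ℂ^{2s}`. -/
def H (s : ℕ) (ϑ b₁ b₂ : ℝ) : Set (Fin (2 * s) → ℂ) :=
  {θ | (∀ j : Fin s, ‖θ (oddIdx j)‖ = ϑ ∧ b₁ ≤ (θ (oddIdx j)).im ∧
          θ (evenIdx j) = (starRingEnd ℂ) (θ (oddIdx j))) ∧
        ∀ i j : Fin (2 * s), i ≠ j → b₂ ≤ ‖θ i - θ j‖}

/-- The dilated open upper half circle `ϑ · 𝕋⁺`, `𝕋⁺ = {e^{2πiα} : α ∈ (0, 1/2)}`. -/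
def halfCircle (ϑ : ℝ) : Set ℂ :=
  {w | ∃ α ∈ Set.Ioo (0 : ℝ) (1 / 2), w = ϑ * Complex.exp (2 * Real.pi * Complex.I * α)}

/-- The distance from a real number to the nearest integer, as the norm in `ℝ / ℤ`. -/
def distInt (x : ℝ) : ℝ := ‖(x : UnitAddCircle)‖

/-- The number `N(z)`: for `ϑ > 1` and `‖z‖_∞ ≥ 1`, the integer `N` such that
`ϑ^{-N} ‖z‖_∞ ∈ [1, ϑ)` (see `scale_spec`). The norm on `Fin (2 * s) → ℂ` is the sup-norm. -/
def scale {s : ℕ} (ϑ : ℝ) (z : Fin (2 * s) → ℂ) : ℕ := ⌊Real.logb ϑ ‖z‖⌋₊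

/-- The renormalized vector `τ_j = θ_j^{-N(z)} z_j`. -/
def tau {s : ℕ} (ϑ : ℝ) (θ z : Fin (2 * s) → ℂ) (j : Fin (2 * s)) : ℂ :=
  (θ j ^ scale ϑ z)⁻¹ * z j

/-- The majorant `Ψ(θ, ε, z) = ∏_{n=0}^{N(z)} (1 - 2πε ‖∑_j θ_j^n τ_j‖²_{ℝ/ℤ})`. When `θ` and `z`
are paired by conjugation the sum is a real number (see `sum_im_eq_zero`), so that taking its real
part is only a change of type. -/
def Psi {s : ℕ} (ϑ : ℝ) (θ : Fin (2 * s) → ℂ) (ε : ℝ) (z : Fin (2 * s) → ℂ) : ℝ :=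
  ∏ n ∈ Finset.range (scale ϑ z + 1),
    (1 - 2 * Real.pi * ε * distInt (∑ j, θ j ^ n * tau ϑ θ z j).re ^ 2)

theorem scale_spec {s : ℕ} {ϑ : ℝ} (hϑ : 1 < ϑ) (z : Fin (2 * s) → ℂ) (hz : 1 ≤ ‖z‖) :
    1 ≤ (ϑ ^ scale ϑ z)⁻¹ * ‖z‖ ∧ (ϑ ^ scale ϑ z)⁻¹ * ‖z‖ < ϑ := by
  have h0 : (0 : ℝ) < ϑ := by linarith
  have hp : 0 < ϑ ^ scale ϑ z := pow_pos h0 _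
  have hz0 : 0 < ‖z‖ := by linarith
  have hl : 0 ≤ Real.logb ϑ ‖z‖ := Real.logb_nonneg hϑ hz
  have h1 : ϑ ^ scale ϑ z ≤ ‖z‖ := by
    rw [← Real.rpow_natCast, ← Real.le_logb_iff_rpow_le hϑ hz0]
    exact Nat.floor_le hl
  have h2 : ‖z‖ < ϑ ^ (scale ϑ z + 1) := by
    rw [← Real.rpow_natCast, ← Real.logb_lt_iff_lt_rpow hϑ hz0]
    push_cast
    exact Nat.lt_floor_add_one _
  rw [inv_mul_eq_div, one_le_div hp, div_lt_iff₀ hp]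
  exact ⟨h1, by rw [pow_succ] at h2; linarith⟩

theorem sum_im_eq_zero {s : ℕ} (ϑ : ℝ) (θ z : Fin (2 * s) → ℂ) (hθ : ConjPaired θ)
    (hz : ConjPaired z) (n : ℕ) : (∑ j, θ j ^ n * tau ϑ θ z j).im = 0 := by
  have key : ∀ f : Fin (2 * s) → ℂ, ∑ j, f j = ∑ j : Fin s, (f (oddIdx j) + f (evenIdx j)) := by
    intro f
    rw [← (finProdFinEquiv.trans (finCongr (Nat.mul_comm s 2))).sum_comp, Fintype.sum_prod_type]
    refine Finset.sum_congr rfl fun j _ => ?_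
    rw [Fin.sum_univ_two]
    congr 2
    · ext; simp [oddIdx]
    · ext; simp [evenIdx]; omega
  rw [key, Complex.im_sum]
  refine Finset.sum_eq_zero fun j _ => ?_
  have h : θ (evenIdx j) ^ n * tau ϑ θ z (evenIdx j)
      = (starRingEnd ℂ) (θ (oddIdx j) ^ n * tau ϑ θ z (oddIdx j)) := by
    simp [tau, hθ j, hz j]
  rw [h, Complex.add_im, Complex.conj_im, add_neg_cancel]

end FourierDecay

end

noncomputable section

namespace FourierDecay

open Finset Filter Topology MeasureTheory
open scoped ENNReal NNReal

/-! This is an Erdős–Kahane argument. Put `x_n = ∑_j θ_j^n τ_j` and let `K_n` be the nearest integer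
to `x_n`. If more than `κ(N+1)` of the `x_n` with `n ≤ N` stay away from the integers, each
contributes a factor bounded below 1 in absolute value, so `Ψ` is exponentially small in `N`, hence
at most a negative power of `‖z‖ < ϑ^(N+1)`. The exceptional set consists of the free coordinates
`w` for which this fails at infinitely many scales `N`; it remains to bound its dimension.

The polynomial with the fixed coordinates as roots, used as a linear filter, removes every
exponential except those of `w` and its conjugate (`filt_traceSeq`). What remains satisfies `y_{n+2}
= a y_{n+1} - ϑ² y_n` with `a = 2 Re w` and grows like `ϑ^n` (`isTrace_traceSeq`). Hence `d + 4`
consecutive integers `K_n`, with `d` the number of fixed coordinates, estimate `a` and predict the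
next one. The prediction has bounded error, and is exact when the `x_n` involved are close to
integers (`abs_code_le`, `code_eq_zero`). The prediction errors therefore form a bounded integer
vector, sparse for exceptional `w`, from which `K_0, …, K_N` are recovered. There are few such
vectors (`card_sparseCodes_le`), and each determines `w` up to `O(ϑ^{-N})` (`ediam_cell_le`).
Summing over these covers gives dimension at most `β` when `κ` is small. All constants are uniform
in the fixed coordinates. -/

/-! ### Hausdorff dimension of limsup sets -/

/-- A limsup set of finite families of sets whose `β`-th powers of diameters are summable has
Hausdorff dimension at most `β`. -/
theorem dimH_limsup_le {X : Type*} [EMetricSpace X] {ι : ℕ → Type*} [∀ n, Fintype (ι n)]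
    (U : ∀ n, ι n → Set X) (E : Set X) (hE : ∀ x ∈ E, ∀ k, ∃ n, ∃ i, x ∈ U (n + k) i)
    (β : ℝ≥0) (r : ℕ → ℝ≥0∞) (hr : Antitone r) (hr0 : Tendsto r atTop (𝓝 0))
    (hU : ∀ n i, Metric.ediam (U n i) ≤ r n)
    (hsum : ∑' n, (Fintype.card (ι n) : ℝ≥0∞) * r n ^ (β : ℝ) ≠ ∞) :
    dimH E ≤ β := by
  borelize X
  refine dimH_le_of_hausdorffMeasure_ne_top (d := β) ?_
  -- The `k`-th cover uses all levels from `k` on, so its cost is bounded by a tail of the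
  -- convergent series and the `β`-dimensional measure is zero.
  have h := Measure.hausdorffMeasure_le_liminf_tsum (ι := fun k => Σ n, ι (n + k)) (β : ℝ) E
    (l := atTop) r hr0 (fun k i => U (i.1 + k) i.2)
    (Eventually.of_forall fun k i => (hU _ _).trans (hr (Nat.le_add_left _ _)))
    (Eventually.of_forall fun k x hx => by
      obtain ⟨n, i, hi⟩ := hE x hx k
      exact Set.mem_iUnion.2 ⟨⟨n, i⟩, hi⟩)
  have h2 : Tendsto (fun k => ∑' i : (Σ n, ι (n + k)), Metric.ediam (U (i.1 + k) i.2) ^ (β : ℝ))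
      atTop (𝓝 0) := by
    refine tendsto_of_tendsto_of_tendsto_of_le_of_le tendsto_const_nhds
      (ENNReal.tendsto_sum_nat_add _ hsum) (fun _ => zero_le) fun k => ?_
    simp only
    rw [ENNReal.tsum_sigma']
    refine ENNReal.tsum_le_tsum fun n => ?_
    rw [tsum_fintype]
    refine (sum_le_card_nsmul _ _ (r (n + k) ^ (β : ℝ)) fun i _ => ?_).trans ?_
    · exact ENNReal.rpow_le_rpow (hU _ _) β.2
    · simp
  rw [h2.liminf_eq] at h
  exact ne_top_of_le_ne_top ENNReal.zero_ne_top h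

/-! ### Counting sparse integer vectors -/

/-- Integer vectors with entries in `[-B, B]` and at most `M` nonzero entries. -/
def sparseCodes (N B : ℕ) (M : ℝ) : Finset (Fin N → ℤ) :=
  {e ∈ Fintype.piFinset fun _ => Icc (-(B : ℤ)) B | (#{i | e i ≠ 0} : ℝ) ≤ M}

/-- Chernoff-type count: with weight `t` per nonzero entry, a sparse vector weighs at least `t ^ M`,
while the total weight of the box factors over coordinates. -/
theorem card_sparseCodes_le (N B : ℕ) (M t : ℝ) (ht : 0 < t) (ht1 : t ≤ 1) :
    (#(sparseCodes N B M) : ℝ) ≤ t ^ (-M) * (1 + 2 * B * t) ^ N := by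
  have hw : ∑ x ∈ Icc (-(B : ℤ)) B, (if x ≠ 0 then t else 1) = 1 + 2 * B * t := by
    rw [← Finset.add_sum_erase _ _ (a := (0 : ℤ)) (by simp)]
    rw [Finset.sum_congr rfl (g := fun _ => t)]
    · rw [sum_const, card_erase_of_mem (by simp), Int.card_Icc]
      have : ((B : ℤ) + 1 - -(B : ℤ)).toNat - 1 = 2 * B := by omega
      rw [this]; simp
    · intro x hx
      simp [(mem_erase.1 hx).1]
  have h1 : (1 + 2 * B * t) ^ N
      = ∑ e ∈ Fintype.piFinset fun _ : Fin N => Icc (-(B : ℤ)) B,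
        ∏ i, (if e i ≠ 0 then t else 1) := by
    rw [← hw, sum_pow' _ (fun x : ℤ => if x ≠ 0 then t else 1)]
  have h2 : (#(sparseCodes N B M) : ℝ) * t ^ M ≤ (1 + 2 * B * t) ^ N := by
    rw [h1, ← nsmul_eq_mul]
    refine (card_nsmul_le_sum (sparseCodes N B M)
      (fun e => ∏ i, (if e i ≠ 0 then t else 1)) _ fun e he => ?_).trans
      (sum_le_sum_of_subset_of_nonneg (filter_subset _ _) fun e _ _ =>
        prod_nonneg fun i _ => by split_ifs <;> positivity)
    rw [← prod_filter, prod_const, ← Real.rpow_natCast]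
    exact Real.rpow_le_rpow_of_exponent_ge ht ht1 (mem_filter.1 he).2
  rw [Real.rpow_neg ht.le, inv_mul_eq_div, le_div_iff₀ (Real.rpow_pos_of_pos ht M)]
  exact h2

/-! ### Linear filters of sequences -/

/-- The sequence `n ↦ q₀ x_n + ⋯ + q_d x_{n+d}`. -/
def filt (q : ℕ → ℂ) (d : ℕ) (x : ℕ → ℂ) (n : ℕ) : ℂ := ∑ i ∈ range (d + 1), q i * x (n + i)

theorem norm_filt_sub_le {q : ℕ → ℂ} {d : ℕ} {Q δ : ℝ} (hQ : ∑ i ∈ range (d + 1), ‖q i‖ ≤ Q)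
    {x x' : ℕ → ℂ} {n : ℕ} (h : ∀ i ≤ d, ‖x (n + i) - x' (n + i)‖ ≤ δ) (hδ : 0 ≤ δ) :
    ‖filt q d x n - filt q d x' n‖ ≤ Q * δ := by
  rw [filt, filt, ← sum_sub_distrib]
  refine (norm_sum_le _ _).trans (le_trans ?_ (mul_le_mul_of_nonneg_right hQ hδ))
  rw [sum_mul]
  refine sum_le_sum fun i hi => ?_
  rw [← mul_sub, norm_mul]
  exact mul_le_mul_of_nonneg_left (h i (by simpa [Nat.lt_succ_iff] using hi)) (norm_nonneg _)

/-- On a geometric sequence the filter is multiplication by the value of the polynomial at the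
ratio, so ratios that are roots disappear. -/
theorem filt_sum_pow {ι : Type*} [Fintype ι] (Q : Polynomial ℂ) (θ τ : ι → ℂ) (n : ℕ) :
    filt Q.coeff Q.natDegree (fun n => ∑ j, θ j ^ n * τ j) n
      = ∑ j, θ j ^ n * τ j * Q.eval (θ j) := by
  simp only [filt, mul_sum, Polynomial.eval_eq_sum_range]
  rw [sum_comm]
  refine sum_congr rfl fun j _ => sum_congr rfl fun i _ => ?_
  rw [pow_add]; ring

/-- The defect of a sequence in the recurrence `y_{n+2} = a y_{n+1} - ϑ² y_n`. -/
def defect (ϑ : ℝ) (a : ℂ) (y : ℕ → ℂ) (n : ℕ) : ℂ := y (n + 2) + ϑ ^ 2 * y n - a * y (n + 1)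

theorem norm_defect_le {ϑ η : ℝ} (hϑ : 0 ≤ ϑ) {a : ℂ} (ha : ‖a‖ ≤ 2 * ϑ) {y Y : ℕ → ℂ} {n : ℕ}
    (hy : defect ϑ a y n = 0) (h : ∀ i ≤ 2, ‖Y (n + i) - y (n + i)‖ ≤ η) :
    ‖defect ϑ a Y n‖ ≤ (1 + ϑ) ^ 2 * η := by
  have e : defect ϑ a Y n = (Y (n + 2) - y (n + 2)) + ϑ ^ 2 * (Y (n + 0) - y (n + 0))
      - a * (Y (n + 1) - y (n + 1)) := by
    rw [← sub_zero (defect ϑ a Y n), ← hy]; simp only [defect, add_zero]; ring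
  have h0 := h 0 (by norm_num)
  have h1 := h 1 (by norm_num)
  have h2 := h 2 le_rfl
  have hη : 0 ≤ η := (norm_nonneg _).trans h0
  rw [e]
  refine (norm_sub_le _ _).trans ((add_le_add_left (norm_add_le _ _) _).trans ?_)
  rw [norm_mul, norm_mul, norm_pow, Complex.norm_real, Real.norm_eq_abs, sq_abs]
  have := mul_le_mul_of_nonneg_left h0 (sq_nonneg ϑ)
  have := mul_le_mul ha h1 (norm_nonneg _) (by positivity)
  nlinarith

/-! ### Estimating the parameter and predicting the sequence -/

/-- The least squares estimate of the parameter `a` of a recurrence `y_{n+2} = a y_{n+1} - ϑ² y_n`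
from the values `y_m, …, y_{m+3}`. -/
def est (ϑ : ℝ) (Y : ℕ → ℂ) (m : ℕ) : ℂ :=
  ((starRingEnd ℂ) (Y (m + 1)) * (Y (m + 2) + ϑ ^ 2 * Y m)
    + (starRingEnd ℂ) (Y (m + 2)) * (Y (m + 3) + ϑ ^ 2 * Y (m + 1)))
    / ((‖Y (m + 1)‖ ^ 2 + ‖Y (m + 2)‖ ^ 2 : ℝ) : ℂ)

/-- The error of the estimate is a weighted mean of two defects, and `(u + v)² ≤ 2(u² + v²)`. Two
consecutive terms are used because a single term of an oscillating solution may nearly vanish. -/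
theorem norm_est_sub_mul_le {ϑ r : ℝ} {a : ℂ} {Y : ℕ → ℂ} {m : ℕ}
    (hS : 0 < ‖Y (m + 1)‖ + ‖Y (m + 2)‖)
    (h0 : ‖defect ϑ a Y m‖ ≤ r) (h1 : ‖defect ϑ a Y (m + 1)‖ ≤ r) :
    ‖est ϑ Y m - a‖ * (‖Y (m + 1)‖ + ‖Y (m + 2)‖) ≤ 2 * r := by
  set u := ‖Y (m + 1)‖ with hu
  set v := ‖Y (m + 2)‖ with hv
  have hu0 : 0 ≤ u := norm_nonneg _
  have hv0 : 0 ≤ v := norm_nonneg _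
  have hD : 0 < u ^ 2 + v ^ 2 := by nlinarith [sq_nonneg (u - v), mul_pos hS hS]
  have hr : 0 ≤ r := (norm_nonneg _).trans h0
  have hDc : ((u ^ 2 + v ^ 2 : ℝ) : ℂ) ≠ 0 := by exact_mod_cast hD.ne'
  have e : est ϑ Y m - a = ((starRingEnd ℂ) (Y (m + 1)) * defect ϑ a Y m
      + (starRingEnd ℂ) (Y (m + 2)) * defect ϑ a Y (m + 1)) / ((u ^ 2 + v ^ 2 : ℝ) : ℂ) := by
    rw [eq_div_iff hDc, sub_mul, est, ← hu, ← hv, div_mul_cancel₀ _ hDc]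
    have c1 := Complex.conj_mul' (Y (m + 1))
    have c2 := Complex.conj_mul' (Y (m + 2))
    rw [← hu] at c1
    rw [← hv] at c2
    push_cast
    rw [← c1, ← c2]
    simp only [defect, add_assoc]
    norm_num
    ring
  have h3 : ‖est ϑ Y m - a‖ * (u ^ 2 + v ^ 2) ≤ r * (u + v) := by
    rw [e, norm_div, Complex.norm_real, Real.norm_eq_abs, abs_of_pos hD, div_mul_cancel₀ _ hD.ne']
    refine (norm_add_le _ _).trans ?_
    rw [norm_mul, norm_mul, RCLike.norm_conj, RCLike.norm_conj, ← hu, ← hv]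
    nlinarith [mul_le_mul_of_nonneg_left h0 hu0, mul_le_mul_of_nonneg_left h1 hv0]
  have h4 : ‖est ϑ Y m - a‖ * (u + v) ^ 2 ≤ 2 * r * (u + v) := by
    nlinarith [mul_nonneg (norm_nonneg (est ϑ Y m - a)) (sq_nonneg (u - v))]
  exact le_of_mul_le_mul_right (by linarith) hS

/-- The error of the estimate is `O(r / S)` and the term it multiplies is `O(S)`, so the growth
cancels and the prediction error is `O(r)` at every index. -/
theorem norm_est_mul_sub_le {ϑ r : ℝ} (hϑ : 0 ≤ ϑ) {a : ℂ} (ha : ‖a‖ ≤ 2 * ϑ) {Y : ℕ → ℂ} {m : ℕ}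
    (hS : 1 ≤ ‖Y (m + 1)‖ + ‖Y (m + 2)‖)
    (h : ∀ i ≤ 2, ‖defect ϑ a Y (m + i)‖ ≤ r) :
    ‖est ϑ Y m * Y (m + 3) - ϑ ^ 2 * Y (m + 2) - Y (m + 4)‖
      ≤ r * (1 + 4 * ϑ + 2 * ϑ ^ 2 + 2 * r) := by
  have h0 := h 0 (by norm_num)
  rw [add_zero] at h0
  have h1 := h 1 (by norm_num)
  have h2 := h 2 le_rfl
  have he := norm_est_sub_mul_le (by linarith) h0 h1
  set S := ‖Y (m + 1)‖ + ‖Y (m + 2)‖ with hSd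
  have hr : 0 ≤ r := (norm_nonneg _).trans h0
  have h3 : ‖Y (m + 3)‖ ≤ (2 * ϑ + ϑ ^ 2 + r) * S := by
    have e : Y (m + 3) = defect ϑ a Y (m + 1) - ϑ ^ 2 * Y (m + 1) + a * Y (m + 2) := by
      simp only [defect, add_assoc]; norm_num; ring
    rw [e]
    refine (norm_add_le _ _).trans ((add_le_add_left (norm_sub_le _ _) _).trans ?_)
    rw [norm_mul, norm_mul, norm_pow, Complex.norm_real, Real.norm_eq_abs, sq_abs]
    have n1 := norm_nonneg (Y (m + 1))
    have n2 := norm_nonneg (Y (m + 2))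
    have := mul_le_mul_of_nonneg_right ha n2
    have a1 : r ≤ r * S := le_mul_of_one_le_right hr hS
    have a2 : ϑ ^ 2 * ‖Y (m + 1)‖ ≤ ϑ ^ 2 * S :=
      mul_le_mul_of_nonneg_left (by linarith) (sq_nonneg _)
    have a3 : 2 * ϑ * ‖Y (m + 2)‖ ≤ 2 * ϑ * S :=
      mul_le_mul_of_nonneg_left (by linarith) (by positivity)
    linarith
  have e : est ϑ Y m * Y (m + 3) - ϑ ^ 2 * Y (m + 2) - Y (m + 4)
      = (est ϑ Y m - a) * Y (m + 3) - defect ϑ a Y (m + 2) := by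
    simp only [defect, add_assoc]; norm_num; ring
  rw [e]
  refine (norm_sub_le _ _).trans ?_
  rw [norm_mul]
  have := mul_le_mul_of_nonneg_left h3 (norm_nonneg (est ϑ Y m - a))
  have h5 : ‖est ϑ Y m - a‖ * ((2 * ϑ + ϑ ^ 2 + r) * S) ≤ 2 * r * (2 * ϑ + ϑ ^ 2 + r) := by
    have := mul_le_mul_of_nonneg_right he (show 0 ≤ 2 * ϑ + ϑ ^ 2 + r by positivity)
    linarith
  nlinarith

/-- The prediction of the term of index `m + 4 + d` of an integer sequence from the preceding
`d + 4` terms. -/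
def predict (ϑ : ℝ) (q : ℕ → ℂ) (d : ℕ) (K : ℕ → ℤ) (m : ℕ) : ℤ :=
  round (est ϑ (filt q d fun n => K n) m * filt q d (fun n => K n) (m + 3)
    - ϑ ^ 2 * filt q d (fun n => K n) (m + 2) - ∑ i ∈ range d, q i * (K (m + 4 + i) : ℂ)).re

theorem filt_congr {q : ℕ → ℂ} {d : ℕ} {x x' : ℕ → ℂ} {n : ℕ}
    (h : ∀ i ≤ n + d, x i = x' i) : filt q d x n = filt q d x' n :=
  sum_congr rfl fun i hi => by
    rw [h (n + i) (Nat.add_le_add_left (Nat.lt_succ_iff.1 (mem_range.1 hi)) n)]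

theorem est_filt_congr {ϑ : ℝ} {q : ℕ → ℂ} {d : ℕ} {x x' : ℕ → ℂ} {m : ℕ}
    (h : ∀ i ≤ m + 3 + d, x i = x' i) :
    est ϑ (filt q d x) m = est ϑ (filt q d x') m := by
  have h' : ∀ j ≤ 3, filt q d x (m + j) = filt q d x' (m + j) := fun j hj =>
    filt_congr fun i hi => h i (by omega)
  have h0 := h' 0 (by norm_num)
  rw [add_zero] at h0
  rw [est, est, h0, h' 1 (by norm_num), h' 2 (by norm_num), h' 3 le_rfl]

theorem predict_congr {ϑ : ℝ} {q : ℕ → ℂ} {d : ℕ} {K K' : ℕ → ℤ} {m : ℕ}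
    (h : ∀ i < m + 4 + d, K i = K' i) : predict ϑ q d K m = predict ϑ q d K' m := by
  have hc : ∀ i ≤ m + 3 + d, (K i : ℂ) = K' i := fun i hi => by rw [h i (by omega)]
  rw [predict, predict, est_filt_congr (x := fun n => (K n : ℂ)) (x' := fun n => (K' n : ℂ)) hc,
    filt_congr (n := m + 3) (x := fun n => (K n : ℂ)) (x' := fun n => (K' n : ℂ)) hc,
    filt_congr (n := m + 2) (x := fun n => (K n : ℂ)) (x' := fun n => (K' n : ℂ))
      fun i hi => hc i (by omega),
    sum_congr rfl fun i hi => by rw [h (m + 4 + i) (by have := mem_range.1 hi; omega)]]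

/-- The deviation of an integer sequence from its prediction; the first `L + d + 4` terms are
recorded as they are. -/
def code (ϑ : ℝ) (q : ℕ → ℂ) (d L : ℕ) (K : ℕ → ℤ) (n : ℕ) : ℤ :=
  if n < L + d + 4 then K n else K n - predict ϑ q d K (n - (d + 4))

/-- Each prediction uses earlier terms only, so the sequence is rebuilt from its code by strong
induction. -/
theorem eq_of_code_eq {ϑ : ℝ} {q : ℕ → ℂ} {d L N : ℕ} {K K' : ℕ → ℤ}
    (h : ∀ n ≤ N, code ϑ q d L K n = code ϑ q d L K' n) : ∀ n ≤ N, K n = K' n := by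
  intro n
  induction n using Nat.strong_induction_on with
  | _ n ih =>
    intro hn
    have hc := h n hn
    unfold code at hc
    split_ifs at hc with hL
    · exact hc
    · rw [predict_congr fun i hi => ih i (by omega) (by omega)] at hc
      linarith

/-! ### Nearest integers of real sequences -/

theorem distInt_eq (x : ℝ) : distInt x = |x - round x| := UnitAddCircle.norm_eq

theorem distInt_nonneg (x : ℝ) : 0 ≤ distInt x := norm_nonneg _

theorem distInt_le_half (x : ℝ) : distInt x ≤ 1 / 2 := by
  rw [distInt_eq]; exact abs_sub_round x

theorem norm_round_sub (x : ℝ) : ‖((round x : ℤ) : ℂ) - (x : ℂ)‖ = distInt x := by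
  rw [distInt_eq, abs_sub_comm, ← Real.norm_eq_abs, ← Complex.norm_real]; push_cast; rfl

/-- A real sequence which the filter `q` turns into a solution of the recurrence
`y_{n+2} = a y_{n+1} - ϑ² y_n` of growth at least `c ϑ^n`. -/
structure IsTrace (ϑ Q c D : ℝ) (q : ℕ → ℂ) (d : ℕ) (a : ℂ) (x : ℕ → ℝ) : Prop where
  norm_param : ‖a‖ ≤ 2 * ϑ
  lead : q d = 1
  sum_le : ∑ i ∈ range (d + 1), ‖q i‖ ≤ Q
  recurrence : ∀ n, defect ϑ a (filt q d fun n => x n) n = 0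
  lower : ∀ n, c * ϑ ^ n ≤ ‖filt q d (fun n => x n) (n + 1)‖ + ‖filt q d (fun n => x n) (n + 2)‖
  upper : ∀ n, |x n| ≤ D * ϑ ^ n

/-- The factor by which the prediction amplifies the distances to the nearest integers. -/
def gain (ϑ Q : ℝ) : ℝ := (1 + ϑ) ^ 2 * Q * (1 + 4 * ϑ + 2 * ϑ ^ 2 + (1 + ϑ) ^ 2 * Q)

/-- The indices `n ≤ N` at which `x n` is at distance more than `ρ` from the integers. -/
def farIndices (ρ : ℝ) (x : ℕ → ℝ) (N : ℕ) : Finset ℕ :=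
  {n ∈ range (N + 1) | ρ < distInt (x n)}

/-! ### Traces near the integers have sparse, bounded codes -/

namespace IsTrace

variable {ϑ Q c D : ℝ} {q : ℕ → ℂ} {d : ℕ} {a : ℂ} {x : ℕ → ℝ}

theorem one_le_bound (h : IsTrace ϑ Q c D q d a x) : 1 ≤ Q := by
  refine le_trans ?_ h.sum_le
  refine le_trans ?_ (single_le_sum (f := fun i => ‖q i‖) (fun i _ => norm_nonneg _)
    (self_mem_range_succ d))
  simp [h.lead]

theorem norm_filt_round_sub_le (h : IsTrace ϑ Q c D q d a x) {n : ℕ} {δ : ℝ} (hδ0 : 0 ≤ δ)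
    (hδ : ∀ i ≤ d, distInt (x (n + i)) ≤ δ) :
    ‖filt q d (fun n => (round (x n) : ℤ)) n - filt q d (fun n => x n) n‖ ≤ Q * δ :=
  norm_filt_sub_le h.sum_le (fun i hi => by
    rw [norm_round_sub]; exact hδ i hi) hδ0

theorem norm_defect_round_le (h : IsTrace ϑ Q c D q d a x) (hϑ : 0 ≤ ϑ) {n : ℕ} {δ : ℝ}
    (hδ0 : 0 ≤ δ) (hδ : ∀ i ≤ d + 2, distInt (x (n + i)) ≤ δ) :
    ‖defect ϑ a (filt q d fun n => (round (x n) : ℤ)) n‖ ≤ (1 + ϑ) ^ 2 * (Q * δ) :=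
  norm_defect_le hϑ h.norm_param (h.recurrence n) fun j hj =>
    h.norm_filt_round_sub_le hδ0 fun i hi => by
      rw [add_assoc]; exact hδ _ (by omega)

/-- Rounding costs at most `Q / 2` in each of the two terms; the hypothesis on `m` makes this at
most half of the growth, and leaves a lower bound `Q ≥ 1`. -/
theorem lower_round (h : IsTrace ϑ Q c D q d a x) {m : ℕ} (hm : 2 * Q ≤ c * ϑ ^ m) :
    c / 2 * ϑ ^ m ≤ ‖filt q d (fun n => (round (x n) : ℤ)) (m + 1)‖
      + ‖filt q d (fun n => (round (x n) : ℤ)) (m + 2)‖ := by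
  have h1 := h.norm_filt_round_sub_le (n := m + 1) (by norm_num) fun i _ => distInt_le_half _
  have h2 := h.norm_filt_round_sub_le (n := m + 2) (by norm_num) fun i _ => distInt_le_half _
  rw [norm_sub_rev] at h1 h2
  have := (norm_sub_norm_le _ _).trans h1
  have := (norm_sub_norm_le _ _).trans h2
  have := h.lower m
  linarith

/-- Rounding errors are always at most `1/2`, so the integers alone determine the parameter up to
`O(ϑ^{-m})`, whether or not the terms are close to integers. -/
theorem norm_est_sub_le (h : IsTrace ϑ Q c D q d a x) (hϑ : 0 ≤ ϑ) {m : ℕ}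
    (hm : 2 * Q ≤ c * ϑ ^ m) :
    ‖est ϑ (filt q d fun n => (round (x n) : ℤ)) m - a‖ * (c / 2 * ϑ ^ m)
      ≤ (1 + ϑ) ^ 2 * Q := by
  have hl := h.lower_round hm
  have hQ := h.one_le_bound
  have := norm_est_sub_mul_le (by linarith)
    (h.norm_defect_round_le hϑ (n := m) (by norm_num) fun i _ => distInt_le_half _)
    (h.norm_defect_round_le hϑ (n := m + 1) (by norm_num) fun i _ => distInt_le_half _)
  have := mul_le_mul_of_nonneg_left hl
    (norm_nonneg (est ϑ (filt q d fun n => (round (x n) : ℤ)) m - a))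
  linarith

theorem abs_predict_sub_le (h : IsTrace ϑ Q c D q d a x) (hϑ : 0 ≤ ϑ) {m : ℕ}
    (hm : 2 * Q ≤ c * ϑ ^ m) {δ : ℝ} (hδ0 : 0 ≤ δ) (hδ1 : δ ≤ 1 / 2)
    (hδ : ∀ i ≤ d + 4, distInt (x (m + i)) ≤ δ) :
    ∃ p : ℝ, predict ϑ q d (fun n => round (x n)) m = round p ∧
      |p - round (x (m + 4 + d))| ≤ gain ϑ Q * δ := by
  refine ⟨_, rfl, ?_⟩
  set Y := filt q d (fun n => ((round (x n) : ℤ) : ℂ)) with hY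
  have hQ := h.one_le_bound
  have hl := h.lower_round hm
  have hr := norm_est_mul_sub_le hϑ h.norm_param (Y := Y) (m := m) (r := (1 + ϑ) ^ 2 * (Q * δ))
    (by linarith) fun j hj => h.norm_defect_round_le hϑ hδ0 fun i hi => by
      rw [add_assoc]; exact hδ _ (by omega)
  -- The filter is monic, so the integer to be predicted is isolated with coefficient 1.
  have hY4 : Y (m + 4) = ∑ i ∈ range d, q i * ((round (x (m + 4 + i)) : ℤ) : ℂ)
      + ((round (x (m + 4 + d)) : ℤ) : ℂ) := by
    rw [hY, filt, sum_range_succ, h.lead, one_mul]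
  rw [hY4, ← sub_sub] at hr
  refine ((Complex.abs_re_le_norm _).trans hr).trans' (le_of_eq ?_) |>.trans ?_
  · rw [Complex.sub_re _ ((round (x (m + 4 + d)) : ℤ) : ℂ), Complex.intCast_re]
  -- The bound is quadratic in `δ`; `δ ≤ 1/2` makes it linear, with the factor `gain`.
  · have : 2 * ((1 + ϑ) ^ 2 * (Q * δ)) ≤ (1 + ϑ) ^ 2 * Q := by
      have : 0 ≤ (1 + ϑ) ^ 2 * Q := by positivity
      nlinarith
    calc _ ≤ (1 + ϑ) ^ 2 * (Q * δ) * (1 + 4 * ϑ + 2 * ϑ ^ 2 + (1 + ϑ) ^ 2 * Q) := by gcongr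
      _ = _ := by rw [gain]; ring

theorem code_eq_zero (h : IsTrace ϑ Q c D q d a x) (hϑ : 1 ≤ ϑ) (hc : 0 ≤ c) {L n : ℕ}
    (hL : 2 * Q ≤ c * ϑ ^ L) (hn : L + d + 4 ≤ n)
    (hρ : ∀ i ≤ d + 4, distInt (x (n - i)) ≤ (4 * gain ϑ Q)⁻¹) :
    code ϑ q d L (fun n => round (x n)) n = 0 := by
  have hQ := h.one_le_bound
  have hG : 1 ≤ gain ϑ Q := by
    have h1 : 1 ≤ (1 + ϑ) ^ 2 := by nlinarith
    have h2 : 1 ≤ (1 + ϑ) ^ 2 * Q := by nlinarith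
    rw [gain]; nlinarith [sq_nonneg ϑ]
  obtain ⟨m, rfl⟩ : ∃ m, n = m + 4 + d := ⟨n - (d + 4), by omega⟩
  have hm : 2 * Q ≤ c * ϑ ^ m := hL.trans
    (mul_le_mul_of_nonneg_left (pow_le_pow_right₀ hϑ (by omega)) hc)
  have hρ1 : (4 * gain ϑ Q)⁻¹ ≤ 1 / 2 := by
    rw [inv_le_comm₀ (by positivity) (by norm_num)]; linarith
  obtain ⟨p, hp, hpx⟩ := h.abs_predict_sub_le (by linarith) hm
    (δ := (4 * gain ϑ Q)⁻¹) (by positivity) hρ1 fun i hi => by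
      have := hρ (d + 4 - i) (by omega)
      rwa [show m + 4 + d - (d + 4 - i) = m + i by omega] at this
  -- With this threshold the real prediction is within `1/4` of the integer, so rounding is exact.
  have h4 : gain ϑ Q * (4 * gain ϑ Q)⁻¹ = 1 / 4 := by field_simp
  rw [h4, abs_le] at hpx
  rw [code, if_neg (by omega), show m + 4 + d - (d + 4) = m by omega, hp, sub_eq_zero, eq_comm,
    round_eq_iff]
  constructor <;> linarith

theorem abs_code_le (h : IsTrace ϑ Q c D q d a x) (hϑ : 1 ≤ ϑ) (hc : 0 ≤ c) (hD : 0 ≤ D) {L : ℕ}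
    (hL : 2 * Q ≤ c * ϑ ^ L) (n : ℕ) :
    |(code ϑ q d L (fun n => round (x n)) n : ℝ)| ≤ gain ϑ Q + D * ϑ ^ (L + d + 4) + 1 := by
  have hQ := h.one_le_bound
  have hG : 0 ≤ gain ϑ Q := by rw [gain]; positivity
  have hDL : 0 ≤ D * ϑ ^ (L + d + 4) := by positivity
  rw [code]
  split_ifs with hn
  · have h1 := h.upper n
    have h2 : D * ϑ ^ n ≤ D * ϑ ^ (L + d + 4) := by gcongr
    have h3 := abs_sub_round (x n)
    rw [abs_le] at *
    constructor <;> linarith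
  · obtain ⟨m, rfl⟩ : ∃ m, n = m + 4 + d := ⟨n - (d + 4), by omega⟩
    have hm : 2 * Q ≤ c * ϑ ^ m := hL.trans
      (mul_le_mul_of_nonneg_left (pow_le_pow_right₀ hϑ (by omega)) hc)
    obtain ⟨p, hp, hpx⟩ := h.abs_predict_sub_le (by linarith) hm
      (δ := 1 / 2) (by norm_num) le_rfl fun i _ => distInt_le_half _
    rw [show m + 4 + d - (d + 4) = m by omega, hp]
    have h3 := abs_sub_round p
    push_cast
    rw [abs_le] at *
    constructor <;> linarith

/-- A far index can spoil only its own code and the next `d + 4`; the initial recorded terms are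
counted separately. -/
theorem card_code_ne_zero_le (h : IsTrace ϑ Q c D q d a x) (hϑ : 1 ≤ ϑ) (hc : 0 ≤ c) {L : ℕ}
    (hL : 2 * Q ≤ c * ϑ ^ L) (N : ℕ) :
    #{i : Fin (N + 1) | code ϑ q d L (fun n => round (x n)) i ≠ 0}
      ≤ (L + d + 4) + (d + 5) * #(farIndices (4 * gain ϑ Q)⁻¹ x N) := by
  set F := farIndices (4 * gain ϑ Q)⁻¹ x N with hF
  have hsub : ∀ i : Fin (N + 1), code ϑ q d L (fun n => round (x n)) i ≠ 0 →
      (i : ℕ) ∈ range (L + d + 4) ∪ (range (d + 5)).biUnion fun j => F.image (· + j) := by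
    intro i hi
    by_contra hcon
    simp only [mem_union, mem_range, mem_biUnion, mem_image, not_or, not_lt, not_exists,
      not_and] at hcon
    refine hi (h.code_eq_zero hϑ hc hL hcon.1 fun j hj => ?_)
    by_contra hlt
    refine hcon.2 j (by omega) (i - j) ?_ (by omega)
    rw [hF, farIndices, mem_filter, mem_range]
    exact ⟨by omega, not_le.1 hlt⟩
  refine (card_le_card_of_injOn
    (t := range (L + d + 4) ∪ (range (d + 5)).biUnion fun j => F.image (· + j))
    (fun i : Fin (N + 1) => (i : ℕ)) (fun i hi => ?_)
    Fin.val_injective.injOn).trans ((card_union_le _ _).trans (add_le_add (card_range _).le ?_))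
  · exact hsub i (by simpa using hi)
  · refine card_biUnion_le.trans ((sum_le_card_nsmul _ _ #F fun j _ => card_image_le).trans ?_)
    simp

theorem code_mem_sparseCodes (h : IsTrace ϑ Q c D q d a x) (hϑ : 1 ≤ ϑ) (hc : 0 ≤ c) (hD : 0 ≤ D)
    {L B : ℕ} (hL : 2 * Q ≤ c * ϑ ^ L) (hB : gain ϑ Q + D * ϑ ^ (L + d + 4) + 1 ≤ B) {N : ℕ}
    {κ : ℝ} (hκ : (#(farIndices (4 * gain ϑ Q)⁻¹ x N) : ℝ) ≤ κ) :
    (fun i : Fin (N + 1) => code ϑ q d L (fun n => round (x n)) i)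
      ∈ sparseCodes (N + 1) B ((L + d + 4) + (d + 5) * κ) := by
  rw [sparseCodes, mem_filter, Fintype.mem_piFinset]
  constructor
  · intro i
    have := (h.abs_code_le hϑ hc hD hL i).trans hB
    rw [mem_Icc, ← abs_le]
    exact_mod_cast this
  · have := h.card_code_ne_zero_le hϑ hc hL N
    calc _ ≤ (((L + d + 4) + (d + 5) * #(farIndices (4 * gain ϑ Q)⁻¹ x N) : ℕ) : ℝ) := by
            exact_mod_cast this
      _ ≤ _ := by push_cast; gcongr

/-- Sequences with equal codes up to `m + 3 + d` have close parameters. -/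
theorem norm_param_sub_le (h : IsTrace ϑ Q c D q d a x) {a' : ℂ} {x' : ℕ → ℝ}
    (h' : IsTrace ϑ Q c D q d a' x') (hϑ : 0 ≤ ϑ) {L m : ℕ} (hm : 2 * Q ≤ c * ϑ ^ m)
    (hcode : ∀ n ≤ m + 3 + d, code ϑ q d L (fun n => round (x n)) n
      = code ϑ q d L (fun n => round (x' n)) n) :
    ‖a - a'‖ * (c / 2 * ϑ ^ m) ≤ 2 * ((1 + ϑ) ^ 2 * Q) := by
  have hK := eq_of_code_eq hcode
  have h1 := h.norm_est_sub_le hϑ hm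
  have h2 := h'.norm_est_sub_le hϑ hm
  rw [est_filt_congr (x' := fun n => ((round (x' n) : ℤ) : ℂ))
    fun i hi => by exact_mod_cast hK i hi] at h1
  have h3 := norm_sub_le_norm_sub_add_norm_sub a
    (est ϑ (filt q d fun n => (round (x' n) : ℤ)) m) a'
  rw [norm_sub_rev a (est _ _ _)] at h3
  have h0 : 0 ≤ c / 2 * ϑ ^ m := by linarith [h.one_le_bound]
  have := mul_le_mul_of_nonneg_right h3 h0
  linarith

end IsTrace

/-! ### The sequences attached to vectors of `H` -/

theorem eq_oddIdx_or_evenIdx {s : ℕ} (j : Fin (2 * s)) :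
    (∃ k : Fin s, j = oddIdx k) ∨ ∃ k : Fin s, j = evenIdx k := by
  obtain ⟨j, hj⟩ := j
  rcases Nat.even_or_odd' j with ⟨k, rfl | rfl⟩
  · exact Or.inl ⟨⟨k, by omega⟩, rfl⟩
  · exact Or.inr ⟨⟨k, by omega⟩, rfl⟩

theorem oddIdx_ne_evenIdx {s : ℕ} (k l : Fin s) : oddIdx k ≠ evenIdx l := by
  intro h
  have := congrArg Fin.val h
  simp only [oddIdx, evenIdx] at this
  omega

section

variable {s : ℕ} {ϑ b₁ b₂ : ℝ} {θ z : Fin (2 * s) → ℂ}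

theorem norm_of_mem_H (hθ : θ ∈ H s ϑ b₁ b₂) (j : Fin (2 * s)) : ‖θ j‖ = ϑ := by
  rcases eq_oddIdx_or_evenIdx j with ⟨k, rfl⟩ | ⟨k, rfl⟩
  · exact (hθ.1 k).1
  · rw [(hθ.1 k).2.2, RCLike.norm_conj, (hθ.1 k).1]

theorem norm_tau (hθ : θ ∈ H s ϑ b₁ b₂) (j : Fin (2 * s)) :
    ‖tau ϑ θ z j‖ = (ϑ ^ scale ϑ z)⁻¹ * ‖z j‖ := by
  rw [tau, norm_mul, norm_inv, norm_pow, norm_of_mem_H hθ]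

/-- The real sequence `n ↦ ∑_j θ_j^n τ_j`. -/
def traceSeq (ϑ : ℝ) (θ z : Fin (2 * s) → ℂ) (n : ℕ) : ℝ := (∑ j, θ j ^ n * tau ϑ θ z j).re

theorem coe_traceSeq (hθ : θ ∈ H s ϑ b₁ b₂) (hz : ConjPaired z) (n : ℕ) :
    (traceSeq ϑ θ z n : ℂ) = ∑ j, θ j ^ n * tau ϑ θ z j := by
  apply Complex.ext
  · rfl
  · rw [Complex.ofReal_im, sum_im_eq_zero ϑ θ z (fun j => (hθ.1 j).2.2) hz]

theorem abs_traceSeq_le (hϑ : 1 < ϑ) (hθ : θ ∈ H s ϑ b₁ b₂) (hz : 1 ≤ ‖z‖) (n : ℕ) :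
    |traceSeq ϑ θ z n| ≤ 2 * s * ϑ * ϑ ^ n := by
  refine (Complex.abs_re_le_norm _).trans ((norm_sum_le _ _).trans ?_)
  refine (sum_le_card_nsmul _ _ (ϑ * ϑ ^ n) fun j _ => ?_).trans (le_of_eq ?_)
  · rw [norm_mul, norm_pow, norm_of_mem_H hθ, norm_tau hθ, mul_comm ϑ]
    have h1 : (ϑ ^ scale ϑ z)⁻¹ * ‖z j‖ ≤ (ϑ ^ scale ϑ z)⁻¹ * ‖z‖ := by
      gcongr; exact norm_le_pi_norm z j
    gcongr
    exact h1.trans (scale_spec hϑ z hz).2.le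
  · simp; ring

/-- The indices of the fixed coordinates. -/
abbrev FixedIdx (ℓ : Fin s) : Type := {j : Fin (2 * s) // j ≠ oddIdx ℓ ∧ j ≠ evenIdx ℓ}

/-- A bound for the sum of the absolute values of the coefficients of a monic polynomial of degree
`d` whose roots have absolute value at most `ϑ`. -/
def coeffBound (ϑ : ℝ) (d : ℕ) : ℝ := (d + 1) * (max ϑ 1 ^ d * d.choose (d / 2))

/-- The monic polynomial whose roots are the fixed coordinates. -/
def fixedPoly {ℓ : Fin s} (θ' : FixedIdx ℓ → ℂ) : Polynomial ℂ :=
  ∏ j, (Polynomial.X - Polynomial.C (θ' j))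

variable {ℓ : Fin s} {θ' : FixedIdx ℓ → ℂ}

theorem natDegree_fixedPoly : (fixedPoly θ').natDegree = Fintype.card (FixedIdx ℓ) := by
  rw [fixedPoly, Polynomial.natDegree_finsetProd_X_sub_C_eq_card, Finset.card_univ]

theorem monic_fixedPoly : (fixedPoly θ').Monic := Polynomial.monic_prod_X_sub_C _ _

theorem eval_fixedPoly (w : ℂ) : (fixedPoly θ').eval w = ∏ j, (w - θ' j) := by
  simp [fixedPoly, Polynomial.eval_prod]

theorem sum_norm_coeff_fixedPoly_le (h : ∀ j, ‖θ' j‖ ≤ ϑ) :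
    ∑ i ∈ range (Fintype.card (FixedIdx ℓ) + 1), ‖(fixedPoly θ').coeff i‖
      ≤ coeffBound ϑ (Fintype.card (FixedIdx ℓ)) := by
  refine (sum_le_card_nsmul _ _ (max ϑ 1 ^ (Fintype.card (FixedIdx ℓ)) *
    (Fintype.card (FixedIdx ℓ)).choose (Fintype.card (FixedIdx ℓ) / 2))
    fun i _ => ?_).trans (le_of_eq ?_)
  · have := Polynomial.coeff_bdd_of_roots_le (B := ϑ) (RingHom.id ℂ) (monic_fixedPoly (θ' := θ'))
      (IsAlgClosed.splits _) natDegree_fixedPoly.le (fun w hw => by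
        rw [Polynomial.map_id, Polynomial.mem_roots monic_fixedPoly.ne_zero, Polynomial.IsRoot.def,
          eval_fixedPoly, prod_eq_zero_iff] at hw
        obtain ⟨j, -, hj⟩ := hw
        rw [sub_eq_zero.1 hj]
        exact h j) i
    rwa [Polynomial.map_id] at this
  · rw [card_range, nsmul_eq_mul, coeffBound]; push_cast; rfl

theorem filt_traceSeq (hθ : θ ∈ H s ϑ b₁ b₂) (hθ' : ∀ j, θ j.1 = θ' j) (hz : ConjPaired z)
    (n : ℕ) :
    filt (fixedPoly θ').coeff (Fintype.card (FixedIdx ℓ)) (fun n => traceSeq ϑ θ z n) n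
      = θ (oddIdx ℓ) ^ n * (tau ϑ θ z (oddIdx ℓ) * (fixedPoly θ').eval (θ (oddIdx ℓ)))
        + θ (evenIdx ℓ) ^ n * (tau ϑ θ z (evenIdx ℓ) * (fixedPoly θ').eval (θ (evenIdx ℓ))) := by
  rw [← natDegree_fixedPoly (θ' := θ')]
  simp only [coe_traceSeq hθ hz]
  rw [filt_sum_pow, Fintype.sum_eq_add (oddIdx ℓ) (evenIdx ℓ) (oddIdx_ne_evenIdx ℓ ℓ),
    mul_assoc, mul_assoc]
  intro j hj
  rw [eval_fixedPoly, prod_eq_zero (mem_univ (⟨j, hj⟩ : FixedIdx ℓ)), mul_zero]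
  rw [← hθ', sub_self]

theorem pow_card_le_norm_eval (hb₂ : 0 < b₂) (hθ : θ ∈ H s ϑ b₁ b₂) (hθ' : ∀ j, θ j.1 = θ' j) :
    b₂ ^ Fintype.card (FixedIdx ℓ) ≤ ‖(fixedPoly θ').eval (θ (oddIdx ℓ))‖ := by
  rw [eval_fixedPoly, norm_prod, ← Finset.card_univ, ← prod_const]
  refine prod_le_prod (fun _ _ => hb₂.le) fun j _ => ?_
  rw [← hθ']
  exact hθ.2 _ _ j.2.1.symm

theorem isTrace_traceSeq (hϑ : 1 < ϑ) (hb₁ : 0 < b₁) (hb₂ : 0 < b₂) (hθ : θ ∈ H s ϑ b₁ b₂)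
    (hθ' : ∀ j, θ j.1 = θ' j) (hz : ConjPaired z) (hzℓ : ‖z (oddIdx ℓ)‖ = ‖z‖) (hz1 : 1 ≤ ‖z‖) :
    IsTrace ϑ (coeffBound ϑ (Fintype.card (FixedIdx ℓ)))
      (2 * b₁ * b₂ ^ Fintype.card (FixedIdx ℓ)) (2 * s * ϑ) (fixedPoly θ').coeff
      (Fintype.card (FixedIdx ℓ)) (2 * (θ (oddIdx ℓ)).re : ℝ) (traceSeq ϑ θ z) := by
  have hϑ0 : 0 < ϑ := by linarith
  have he : θ (evenIdx ℓ) = (starRingEnd ℂ) (θ (oddIdx ℓ)) := (hθ.1 ℓ).2.2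
  have hn : ‖θ (oddIdx ℓ)‖ = ϑ := norm_of_mem_H hθ _
  have hsum : ((2 * (θ (oddIdx ℓ)).re : ℝ) : ℂ) = θ (oddIdx ℓ) + θ (evenIdx ℓ) := by
    rw [he, Complex.add_conj]
  have hprod : (ϑ : ℂ) ^ 2 = θ (oddIdx ℓ) * θ (evenIdx ℓ) := by
    rw [he, Complex.mul_conj', hn]
  refine ⟨?_, ?_, sum_norm_coeff_fixedPoly_le fun j => ?_, fun n => ?_, fun n => ?_,
    abs_traceSeq_le hϑ hθ hz1⟩
  · rw [hsum]
    refine (norm_add_le _ _).trans (le_of_eq ?_)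
    rw [norm_of_mem_H hθ, norm_of_mem_H hθ]; ring
  · rw [← natDegree_fixedPoly (θ' := θ')]
    exact monic_fixedPoly
  · rw [← hθ', norm_of_mem_H hθ]
  · rw [defect, filt_traceSeq hθ hθ' hz, filt_traceSeq hθ hθ' hz, filt_traceSeq hθ hθ' hz, hsum,
      hprod]
    ring
  · set y := filt (fixedPoly θ').coeff (Fintype.card (FixedIdx ℓ)) (fun n => traceSeq ϑ θ z n)
      with hy
    set A := tau ϑ θ z (oddIdx ℓ) * (fixedPoly θ').eval (θ (oddIdx ℓ)) with hA
    -- This combination eliminates the conjugate exponential, leaving one term of explicit modulus.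
    have key : y (n + 2) - θ (evenIdx ℓ) * y (n + 1)
        = θ (oddIdx ℓ) ^ (n + 1) * A * (θ (oddIdx ℓ) - θ (evenIdx ℓ)) := by
      rw [hy, filt_traceSeq hθ hθ' hz, filt_traceSeq hθ hθ' hz]
      ring
    -- Maximality of the coordinate `ℓ` of `z` enters here: it makes the corresponding `τ` of
    -- modulus at least 1.
    have hA1 : b₂ ^ Fintype.card (FixedIdx ℓ) ≤ ‖A‖ := by
      rw [hA, norm_mul, norm_tau hθ, hzℓ]
      exact (pow_card_le_norm_eval hb₂ hθ hθ').trans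
        (le_mul_of_one_le_left (norm_nonneg _) (scale_spec hϑ z hz1).1)
    have hdiff : 2 * b₁ ≤ ‖θ (oddIdx ℓ) - θ (evenIdx ℓ)‖ := by
      refine le_trans ?_ (Complex.abs_im_le_norm _)
      rw [he, Complex.sub_im, Complex.conj_im]
      exact le_trans (by linarith [(hθ.1 ℓ).2.1]) (le_abs_self _)
    have h1 : ϑ ^ (n + 1) * b₂ ^ Fintype.card (FixedIdx ℓ) * (2 * b₁)
        ≤ ‖y (n + 2)‖ + ϑ * ‖y (n + 1)‖ := by
      calc _ ≤ ϑ ^ (n + 1) * ‖A‖ * ‖θ (oddIdx ℓ) - θ (evenIdx ℓ)‖ := by gcongr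
        _ = ‖y (n + 2) - θ (evenIdx ℓ) * y (n + 1)‖ := by
            rw [key, norm_mul (_ * A), norm_mul _ A, norm_pow, hn]
        _ ≤ _ := (norm_sub_le _ _).trans (by rw [norm_mul, norm_of_mem_H hθ])
    have h2 : ‖y (n + 2)‖ ≤ ϑ * ‖y (n + 2)‖ := le_mul_of_one_le_left (norm_nonneg _) hϑ.le
    refine le_of_mul_le_mul_left ?_ hϑ0
    rw [pow_succ] at h1
    linarith

/-- On the part of a circle above height `b₁` the real part controls the distance. -/
theorem norm_sub_le_of_re {w w' : ℂ} (hb₁ : 0 < b₁) (hw : ‖w‖ = ϑ) (hw' : ‖w'‖ = ϑ)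
    (him : b₁ ≤ w.im) (him' : b₁ ≤ w'.im) :
    ‖w - w'‖ ≤ (1 + ϑ / b₁) * |w.re - w'.re| := by
  -- Equal moduli give a difference of squares; the imaginary parts sum to at least `2 * b₁`.
  have h1 : (w.im - w'.im) * (w.im + w'.im) = -((w.re - w'.re) * (w.re + w'.re)) := by
    have e1 := Complex.sq_norm w
    have e2 := Complex.sq_norm w'
    rw [hw, Complex.normSq_apply] at e1
    rw [hw', Complex.normSq_apply] at e2
    linarith
  have h2 : |w.im - w'.im| * (2 * b₁) ≤ |w.re - w'.re| * (2 * ϑ) := by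
    have e := congrArg abs h1
    rw [abs_neg, abs_mul, abs_mul] at e
    calc _ ≤ |w.im - w'.im| * |w.im + w'.im| := by
            gcongr; exact le_trans (by linarith) (le_abs_self _)
      _ = |w.re - w'.re| * |w.re + w'.re| := e
      _ ≤ _ := by
            gcongr
            refine (abs_add_le _ _).trans ?_
            have := Complex.abs_re_le_norm w
            have := Complex.abs_re_le_norm w'
            linarith
  have h3 : |w.im - w'.im| ≤ ϑ / b₁ * |w.re - w'.re| := by
    rw [div_mul_eq_mul_div, le_div_iff₀ hb₁]; linarith
  refine (Complex.norm_le_abs_re_add_abs_im _).trans ?_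
  rw [Complex.sub_re, Complex.sub_im]
  linarith

end

/-! ### Decay of the product -/

/-- A factor may be negative, down to `1 - π/2`. The weak exponent leaves room for this: with `u = π
ε δ²`, `2u - 1 ≤ 1 - u/2` needs `u ≤ 4/5`, and `π/4 < 4/5`. -/
theorem abs_one_sub_le_exp {ε ρ δ : ℝ} (hε : 0 ≤ ε) (hε1 : ε ≤ 1) (hρ : 0 ≤ ρ) (hδ : ρ ≤ δ)
    (hδ1 : δ ≤ 1 / 2) :
    |1 - 2 * Real.pi * ε * δ ^ 2| ≤ Real.exp (-(Real.pi * ε * ρ ^ 2 / 2)) := by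
  have hπ := Real.pi_pos
  have hπ1 := Real.pi_lt_d2
  have h1 : ρ ^ 2 ≤ δ ^ 2 := by gcongr
  have h2 : δ ^ 2 ≤ 1 / 4 := by nlinarith
  have h3 : ε * δ ^ 2 ≤ 1 / 4 := by nlinarith [sq_nonneg δ]
  have h4 : 0 ≤ ε * δ ^ 2 := by positivity
  have h5 : Real.pi * (ε * δ ^ 2) ≤ 3.15 * (1 / 4) := by
    apply mul_le_mul hπ1.le h3 h4 (by norm_num)
  have h6 : 0 ≤ Real.pi * (ε * δ ^ 2) := by positivity
  have h7 : Real.pi * (ε * ρ ^ 2) ≤ Real.pi * (ε * δ ^ 2) := by gcongr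
  have h8 := Real.add_one_le_exp (-(Real.pi * ε * ρ ^ 2 / 2))
  refine le_trans ?_ h8
  rw [abs_le]
  constructor <;> linarith

theorem Psi_le_exp {s : ℕ} {ϑ ε ρ : ℝ} (θ z : Fin (2 * s) → ℂ) (hε : 0 ≤ ε) (hε1 : ε ≤ 1)
    (hρ : 0 ≤ ρ) :
    Psi ϑ θ ε z ≤ Real.exp
      (-(Real.pi * ε * ρ ^ 2 / 2) * #(farIndices ρ (traceSeq ϑ θ z) (scale ϑ z))) := by
  refine (le_abs_self _).trans ?_
  rw [Psi, abs_prod, mul_comm (-_), Real.exp_nat_mul, ← prod_const, farIndices, prod_filter]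
  refine prod_le_prod (fun _ _ => abs_nonneg _) fun n _ => ?_
  split_ifs with h
  · exact abs_one_sub_le_exp hε hε1 hρ h.le (distInt_le_half _)
  · refine (abs_one_sub_le_exp hε hε1 le_rfl (distInt_nonneg _) (distInt_le_half _)).trans ?_
    simp

/-- First `t` is chosen so that `1 + 2Bt ≤ e^{g/4}`, then `κ` so that `t^{-(d+5)κ} = e^{g/4}`. The
term `M` is kept apart for the entries that do not scale with `n`. -/
theorem exists_card_sparseCodes_le (B d : ℕ) {g : ℝ} (hg : 0 < g) :
    ∃ κ : ℝ, 0 < κ ∧ ∃ t : ℝ, 0 < t ∧ ∀ (M : ℝ) (n : ℕ),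
      (#(sparseCodes n B (M + (d + 5) * (κ * n))) : ℝ) ≤ t ^ (-M) * Real.exp (g / 2 * n) := by
  set t : ℝ := min (1 / 2) (g / (8 * (B + 1))) with ht
  have ht0 : 0 < t := by rw [ht]; positivity
  have ht1 : t < 1 := (min_le_left _ _).trans_lt (by norm_num)
  have hBt : 2 * B * t ≤ g / 4 := by
    have h1 : t ≤ g / (8 * (B + 1)) := min_le_right _ _
    rw [le_div_iff₀ (by positivity)] at h1
    nlinarith
  have hlog : Real.log t < 0 := Real.log_neg ht0 ht1
  refine ⟨g / (4 * (d + 5) * -Real.log t), ?_, t, ht0, fun M n => ?_⟩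
  · have : 0 < -Real.log t := by linarith
    positivity
  refine (card_sparseCodes_le n B _ t ht0 ht1.le).trans ?_
  rw [neg_add, Real.rpow_add ht0, mul_assoc]
  gcongr
  have h1 : t ^ (-(((d : ℝ) + 5) * (g / (4 * (d + 5) * -Real.log t) * n)))
      = Real.exp (g / 4 * n) := by
    rw [Real.rpow_def_of_pos ht0]
    congr 1
    have := hlog.ne
    field_simp
  have h2 : (1 + 2 * B * t) ^ n ≤ Real.exp (g / 4 * n) := by
    rw [mul_comm (g / 4), Real.exp_nat_mul]
    gcongr
    linarith [Real.add_one_le_exp (g / 4)]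
  rw [h1]
  calc _ ≤ Real.exp (g / 4 * n) * Real.exp (g / 4 * n) := by gcongr
    _ = _ := by rw [← Real.exp_add]; ring_nf

/-! ### The exceptional set -/

section

variable {s : ℕ} {ϑ b₁ b₂ : ℝ} {ℓ : Fin s} {θ' : FixedIdx ℓ → ℂ}

/-- `θ` and `z` are admissible data with free coordinate `w` and scale `N`. -/
structure Admissible (ϑ b₁ b₂ : ℝ) (θ' : FixedIdx ℓ → ℂ) (N : ℕ) (w : ℂ)
    (θ z : Fin (2 * s) → ℂ) : Prop where
  mem : θ ∈ H s ϑ b₁ b₂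
  fixed : ∀ j, θ j.1 = θ' j
  free : θ (oddIdx ℓ) = w
  paired : ConjPaired z
  norm_eq : ‖z (oddIdx ℓ)‖ = ‖z‖
  one_le : 1 ≤ ‖z‖
  scale_eq : scale ϑ z = N

/-- The parameters for which, at scale `N`, at most `κ` terms of some attached sequence are at
distance more than `ρ` from the integers. -/
def exceptional (ϑ b₁ b₂ : ℝ) (θ' : FixedIdx ℓ → ℂ) (ρ κ : ℝ) (N : ℕ) : Set ℂ :=
  {w | ∃ θ z, Admissible ϑ b₁ b₂ θ' N w θ z ∧ (#(farIndices ρ (traceSeq ϑ θ z) N) : ℝ) ≤ κ}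

/-- The parameters with an attached sequence of given code. -/
def cell (ϑ b₁ b₂ : ℝ) (θ' : FixedIdx ℓ → ℂ) (L N : ℕ) (e : Fin (N + 1) → ℤ) : Set ℂ :=
  {w | ∃ θ z, Admissible ϑ b₁ b₂ θ' N w θ z ∧
    (fun i : Fin (N + 1) => code ϑ (fixedPoly θ').coeff (Fintype.card (FixedIdx ℓ)) L
      (fun n => round (traceSeq ϑ θ z n)) i) = e}

theorem Admissible.isTrace {N : ℕ} {w : ℂ} {θ z : Fin (2 * s) → ℂ}
    (h : Admissible ϑ b₁ b₂ θ' N w θ z) (hϑ : 1 < ϑ) (hb₁ : 0 < b₁) (hb₂ : 0 < b₂) :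
    IsTrace ϑ (coeffBound ϑ (Fintype.card (FixedIdx ℓ)))
      (2 * b₁ * b₂ ^ Fintype.card (FixedIdx ℓ)) (2 * s * ϑ) (fixedPoly θ').coeff
      (Fintype.card (FixedIdx ℓ)) (2 * w.re : ℝ) (traceSeq ϑ θ z) := by
  rw [← h.free]
  exact isTrace_traceSeq hϑ hb₁ hb₂ h.mem h.fixed h.paired h.norm_eq h.one_le

/-- A common code up to index `m + 3 + d`, with `m = n + L`, fixes the integers entering the
estimate at `m`; hence `Re w`, and on the arc `w` itself, is known up to `O(ϑ^{-n})`. -/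
theorem ediam_cell_le (hϑ : 1 < ϑ) (hb₁ : 0 < b₁) (hb₂ : 0 < b₂) {L : ℕ}
    (hL : 2 * coeffBound ϑ (Fintype.card (FixedIdx ℓ))
      ≤ 2 * b₁ * b₂ ^ Fintype.card (FixedIdx ℓ) * ϑ ^ L) :
    ∃ C : ℝ, 0 ≤ C ∧ ∀ n (e : Fin (n + L + 3 + Fintype.card (FixedIdx ℓ) + 1) → ℤ),
      Metric.ediam (cell ϑ b₁ b₂ θ' L (n + L + 3 + Fintype.card (FixedIdx ℓ)) e)
        ≤ ENNReal.ofReal (C * ϑ⁻¹ ^ n) := by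
  set d := Fintype.card (FixedIdx ℓ) with hd
  set Q := coeffBound ϑ d
  have hQ0 : 0 ≤ Q := by simp only [Q, coeffBound]; positivity
  set c := 2 * b₁ * b₂ ^ d with hc
  have hc0 : 0 < c := by positivity
  have hϑ0 : 0 < ϑ := by linarith
  refine ⟨(1 + ϑ / b₁) * (2 * ((1 + ϑ) ^ 2 * Q) / c), by positivity, fun n e => ?_⟩
  refine Metric.ediam_le fun w hw w' hw' => ?_
  obtain ⟨θ, z, h, he⟩ := hw
  obtain ⟨θ₁, z₁, h₁, he₁⟩ := hw'
  have hm : 2 * Q ≤ c * ϑ ^ (n + L) := hL.trans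
    (mul_le_mul_of_nonneg_left (pow_le_pow_right₀ hϑ.le (by omega)) hc0.le)
  have hclose := (h.isTrace hϑ hb₁ hb₂).norm_param_sub_le (h₁.isTrace hϑ hb₁ hb₂) hϑ0.le hm
    (L := L) fun k hk => congrFun (he.trans he₁.symm) ⟨k, by omega⟩
  rw [← Complex.ofReal_sub, Complex.norm_real, Real.norm_eq_abs, ← mul_sub, abs_mul, abs_two]
    at hclose
  have hre : |w.re - w'.re| ≤ 2 * ((1 + ϑ) ^ 2 * Q) / c * ϑ⁻¹ ^ n := by
    have h1 : |w.re - w'.re| * (c * ϑ ^ n) ≤ 2 * ((1 + ϑ) ^ 2 * Q) := by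
      refine le_trans ?_ hclose
      have : ϑ ^ n ≤ ϑ ^ (n + L) := pow_le_pow_right₀ hϑ.le (by omega)
      calc _ ≤ |w.re - w'.re| * (c * ϑ ^ (n + L)) := by gcongr
        _ = _ := by ring
    rw [inv_pow, ← div_eq_mul_inv, div_div, le_div_iff₀ (by positivity)]
    exact h1
  rw [edist_dist, Complex.dist_eq]
  refine ENNReal.ofReal_le_ofReal ((norm_sub_le_of_re hb₁ (ϑ := ϑ) ?_ ?_ ?_ ?_).trans ?_)
  · rw [← h.free]; exact norm_of_mem_H h.mem _
  · rw [← h₁.free]; exact norm_of_mem_H h₁.mem _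
  · rw [← h.free]; exact (h.mem.1 ℓ).2.1
  · rw [← h₁.free]; exact (h₁.mem.1 ℓ).2.1
  · rw [mul_assoc]; gcongr

theorem mem_cell_of_mem_exceptional (hϑ : 1 < ϑ) (hb₁ : 0 < b₁) (hb₂ : 0 < b₂) {L B N : ℕ} {κ : ℝ}
    (hL : 2 * coeffBound ϑ (Fintype.card (FixedIdx ℓ))
      ≤ 2 * b₁ * b₂ ^ Fintype.card (FixedIdx ℓ) * ϑ ^ L)
    (hB : gain ϑ (coeffBound ϑ (Fintype.card (FixedIdx ℓ)))
      + 2 * s * ϑ * ϑ ^ (L + Fintype.card (FixedIdx ℓ) + 4) + 1 ≤ B) {w : ℂ}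
    (hw : w ∈ exceptional ϑ b₁ b₂ θ'
      (4 * gain ϑ (coeffBound ϑ (Fintype.card (FixedIdx ℓ))))⁻¹ κ N) :
    ∃ e ∈ sparseCodes (N + 1) B ((L + Fintype.card (FixedIdx ℓ) + 4)
      + (Fintype.card (FixedIdx ℓ) + 5) * κ), w ∈ cell ϑ b₁ b₂ θ' L N e := by
  obtain ⟨θ, z, h, hκ⟩ := hw
  exact ⟨_, (h.isTrace hϑ hb₁ hb₂).code_mem_sparseCodes hϑ.le (by positivity) (by positivity) hL
    hB hκ, θ, z, h, rfl⟩

/-- With `g = β log ϑ` there are `O(e^{gN/2})` cells at scale `N`, each of diameter to the power `β`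
equal to `O(e^{-gN})`, so the covering sums converge geometrically. -/
theorem dimH_exceptional_le (hϑ : 1 < ϑ) (hb₁ : 0 < b₁) (hb₂ : 0 < b₂) {L B : ℕ} {κ t β : ℝ}
    (hβ : 0 < β) (ht : 0 < t)
    (hL : 2 * coeffBound ϑ (Fintype.card (FixedIdx ℓ))
      ≤ 2 * b₁ * b₂ ^ Fintype.card (FixedIdx ℓ) * ϑ ^ L)
    (hB : gain ϑ (coeffBound ϑ (Fintype.card (FixedIdx ℓ)))
      + 2 * s * ϑ * ϑ ^ (L + Fintype.card (FixedIdx ℓ) + 4) + 1 ≤ B)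
    (hcard : ∀ (M : ℝ) (n : ℕ),
      (#(sparseCodes n B (M + (Fintype.card (FixedIdx ℓ) + 5) * (κ * n))) : ℝ)
        ≤ t ^ (-M) * Real.exp (β * Real.log ϑ / 2 * n)) (E : Set ℂ)
    (hE : ∀ w ∈ E, ∀ k, ∃ N ≥ k, w ∈ exceptional ϑ b₁ b₂ θ'
      (4 * gain ϑ (coeffBound ϑ (Fintype.card (FixedIdx ℓ))))⁻¹ (κ * (N + 1 : ℕ)) N) :
    dimH E ≤ ENNReal.ofReal β := by
  obtain ⟨C, hC, hdiam⟩ := ediam_cell_le (θ' := θ') hϑ hb₁ hb₂ hL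
  set d := Fintype.card (FixedIdx ℓ) with hd
  have hϑ0 : 0 < ϑ := by linarith
  have hlog : 0 < Real.log ϑ := Real.log_pos hϑ
  have hinv : ϑ⁻¹ < 1 := inv_lt_one_of_one_lt₀ hϑ
  set M : ℝ := L + d + 4 with hM
  refine dimH_limsup_le (X := ℂ)
    (ι := fun n => {e // e ∈ sparseCodes (n + L + 3 + d + 1) B
      (M + (d + 5) * (κ * (n + L + 3 + d + 1 : ℕ)))})
    (fun n e => cell ϑ b₁ b₂ θ' L (n + L + 3 + d) e.1) E ?_ β.toNNReal
    (fun n => ENNReal.ofReal (C * ϑ⁻¹ ^ n)) ?_ ?_ (fun n e => hdiam n e.1) ?_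
  · intro w hw k
    obtain ⟨N, hN, hwN⟩ := hE w hw (k + L + 3 + d)
    obtain ⟨n, rfl⟩ : ∃ n, N = n + k + L + 3 + d := ⟨N - (k + L + 3 + d), by omega⟩
    obtain ⟨e, he, hwe⟩ := mem_cell_of_mem_exceptional hϑ hb₁ hb₂ hL hB hwN
    exact ⟨n, ⟨e, he⟩, hwe⟩
  · intro m n hmn
    refine ENNReal.ofReal_le_ofReal (mul_le_mul_of_nonneg_left ?_ hC)
    exact pow_le_pow_of_le_one (by positivity) hinv.le hmn
  · rw [← ENNReal.ofReal_zero, ← mul_zero C]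
    exact ENNReal.tendsto_ofReal
      ((tendsto_pow_atTop_nhds_zero_of_lt_one (by positivity) hinv).const_mul C)
  · set g := β * Real.log ϑ with hg
    have hg0 : 0 < g := by positivity
    have hsum : Summable fun n : ℕ => t ^ (-M) * Real.exp (g / 2 * (L + 3 + d + 1)) * C ^ β
        * Real.exp (-(g / 2)) ^ n :=
      (summable_geometric_of_lt_one (Real.exp_pos _).le
        (Real.exp_lt_one_iff.2 (by linarith))).mul_left _
    refine ne_top_of_le_ne_top (ENNReal.ofReal_ne_top (r := ∑' n : ℕ, t ^ (-M) *
      Real.exp (g / 2 * (L + 3 + d + 1)) * C ^ β * Real.exp (-(g / 2)) ^ n)) ?_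
    rw [ENNReal.ofReal_tsum_of_nonneg (fun n => by positivity) hsum]
    refine ENNReal.tsum_le_tsum fun n => ?_
    rw [Fintype.card_coe, Real.coe_toNNReal β hβ.le,
      ENNReal.ofReal_rpow_of_nonneg (by positivity) hβ.le, ← ENNReal.ofReal_natCast,
      ← ENNReal.ofReal_mul (by positivity)]
    refine ENNReal.ofReal_le_ofReal ?_
    have h1 : (C * ϑ⁻¹ ^ n) ^ β = C ^ β * Real.exp (-(g * n)) := by
      rw [Real.mul_rpow hC (by positivity), ← Real.rpow_natCast, ← Real.rpow_mul (by positivity),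
        Real.rpow_def_of_pos (inv_pos.2 hϑ0), Real.log_inv]
      congr 2
      rw [hg]; ring
    rw [h1]
    refine (mul_le_mul_of_nonneg_right (hcard M _) (by positivity)).trans (le_of_eq ?_)
    have h2 : Real.exp (g / 2 * (n + L + 3 + d + 1 : ℕ)) * Real.exp (-(g * n))
        = Real.exp (g / 2 * (L + 3 + d + 1)) * Real.exp (-(g / 2)) ^ n := by
      rw [← Real.exp_nat_mul, ← Real.exp_add, ← Real.exp_add]
      congr 1
      push_cast; ring
    linear_combination (t ^ (-M) * C ^ β) * h2

end

end FourierDecay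

end

/-! ### Choice of constants and conclusion -/

theorem mainTheorem3 (s : ℕ) (hs : 2 ≤ s) (ϑ b₁ b₂ : ℝ) (hϑ : 1 < ϑ) (hb₁ : 0 < b₁)
    (hb₂ : 0 < b₂) :
    -- `C` is the constant `O_H(1)`; the exponent `γ` depends only on `H`, `ℓ`, `β`, `ε`
    ∃ C : ℝ, 0 < C ∧ ∀ (ℓ : Fin s) (β ε : ℝ), 0 < β → 0 < ε →
      ∃ γ : ℝ, 0 < γ ∧
        -- the fixed eigenvalues, compatible with membership in `H`
        ∀ θ' : {j : Fin (2 * s) // j ≠ FourierDecay.oddIdx ℓ ∧ j ≠ FourierDecay.evenIdx ℓ} → ℂ,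
          (∃ θ ∈ FourierDecay.H s ϑ b₁ b₂, ∀ j, θ j.1 = θ' j) →
          ∃ E : Set ℂ, E ⊆ FourierDecay.halfCircle ϑ ∧ dimH E ≤ ENNReal.ofReal β ∧
            ∀ θ ∈ FourierDecay.H s ϑ b₁ b₂, (∀ j, θ j.1 = θ' j) →
              θ (FourierDecay.oddIdx ℓ) ∈ FourierDecay.halfCircle ϑ \ E →
              -- `R` is the threshold `O_θ(1)`
              ∃ R : ℝ, 1 ≤ R ∧ ∀ (m : ℕ) (p : Fin (m + 1) → ℝ), p ∈ stdSimplex ℝ (Fin (m + 1)) →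
                (∀ i, ε ≤ p i) →
                ∀ z : Fin (2 * s) → ℂ, FourierDecay.ConjPaired z →
                  ‖z (FourierDecay.oddIdx ℓ)‖ = ‖z‖ → R ≤ ‖z‖ →
                  FourierDecay.Psi ϑ θ ε z ≤ C * ‖z‖ ^ (-γ) := by
  refine ⟨1, one_pos, fun ℓ β ε hβ hε => ?_⟩
  set d := Fintype.card (FourierDecay.FixedIdx ℓ) with hd
  set G := FourierDecay.gain ϑ (FourierDecay.coeffBound ϑ d) with hG
  have hϑ0 : 0 < ϑ := by linarith
  have hlog : 0 < Real.log ϑ := Real.log_pos hϑ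
  have hQ0 : 0 < FourierDecay.coeffBound ϑ d := by
    have : 0 < d.choose (d / 2) := Nat.choose_pos (Nat.div_le_self d 2)
    unfold FourierDecay.coeffBound
    positivity
  have hG0 : 0 < G := by rw [hG, FourierDecay.gain]; positivity
  obtain ⟨L, hL⟩ : ∃ L : ℕ, 2 * FourierDecay.coeffBound ϑ d ≤ 2 * b₁ * b₂ ^ d * ϑ ^ L := by
    obtain ⟨L, hL⟩ := pow_unbounded_of_one_lt
      (2 * FourierDecay.coeffBound ϑ d / (2 * b₁ * b₂ ^ d)) hϑ
    rw [div_lt_iff₀ (by positivity)] at hL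
    exact ⟨L, by linarith⟩
  obtain ⟨B, hB⟩ := exists_nat_ge (G + 2 * s * ϑ * ϑ ^ (L + d + 4) + 1)
  obtain ⟨κ, hκ, t, ht, hcard⟩ := FourierDecay.exists_card_sparseCodes_le B d
    (mul_pos hβ hlog)
  set b := Real.pi * ε * (4 * G)⁻¹ ^ 2 / 2 with hb
  have hb0 : 0 < b := by have := Real.pi_pos; positivity
  -- Each far index costs `e^{-b}`, and more than `κ(N+1)` of them give `e^{-bκ(N+1)}`; dividing by
  -- `log ϑ` converts this into a power of `‖z‖`.
  refine ⟨b * κ / Real.log ϑ, by positivity, fun θ' _ => ?_⟩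
  refine ⟨{w ∈ FourierDecay.halfCircle ϑ | ∀ k, ∃ N ≥ k, w ∈ FourierDecay.exceptional ϑ b₁ b₂ θ'
    (4 * G)⁻¹ (κ * (N + 1 : ℕ)) N}, Set.sep_subset _ _,
    FourierDecay.dimH_exceptional_le hϑ hb₁ hb₂ hβ ht hL hB hcard _ fun w hw => hw.2,
    fun θ hθ hθ' hmem => ?_⟩
  have hk : ¬ ∀ k, ∃ N ≥ k, θ (FourierDecay.oddIdx ℓ) ∈
      FourierDecay.exceptional ϑ b₁ b₂ θ' (4 * G)⁻¹ (κ * (N + 1 : ℕ)) N :=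
    fun h => hmem.2 ⟨hmem.1, h⟩
  push Not at hk
  obtain ⟨k, hk⟩ := hk
  -- Beyond scale `k` the point is never exceptional, and `‖z‖ ≥ ϑ ^ k` forces the scale of `z` to
  -- be at least `k`.
  refine ⟨ϑ ^ k, one_le_pow₀ hϑ.le, fun m p hp hpε z hz hzℓ hzR => ?_⟩
  -- An entry of a probability vector is at most 1; the factor bound needs this restriction on `ε`.
  have hε1 : ε ≤ 1 := (hpε 0).trans
    ((Finset.single_le_sum (fun i _ => hp.1 i) (Finset.mem_univ 0)).trans hp.2.le)
  have hz1 : 1 ≤ ‖z‖ := (one_le_pow₀ hϑ.le).trans hzR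
  have hz0 : 0 < ‖z‖ := by linarith
  set N := FourierDecay.scale ϑ z with hN
  have hzN : ‖z‖ < ϑ ^ (N + 1) := by
    have := (FourierDecay.scale_spec hϑ z hz1).2
    rwa [inv_mul_eq_div, div_lt_iff₀ (by positivity), ← pow_succ'] at this
  have hkN : k ≤ N :=
    Nat.lt_succ_iff.1 ((pow_lt_pow_iff_right₀ hϑ).1 (hzR.trans_lt hzN))
  have hfar : κ * (N + 1 : ℕ) <
      (FourierDecay.farIndices (4 * G)⁻¹ (FourierDecay.traceSeq ϑ θ z) N).card := by
    by_contra hcon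
    exact hk N hkN ⟨θ, z, ⟨hθ, hθ', rfl, hz, hzℓ, hz1, rfl⟩, not_lt.1 hcon⟩
  refine (FourierDecay.Psi_le_exp θ z hε.le hε1
    (show (0 : ℝ) ≤ (4 * G)⁻¹ by positivity)).trans ?_
  rw [one_mul, Real.rpow_def_of_pos hz0, Real.exp_le_exp, ← hb, ← hN]
  have hlogz : Real.log ‖z‖ ≤ (N + 1 : ℕ) * Real.log ϑ := by
    rw [← Real.log_pow]
    exact Real.log_le_log hz0 hzN.le
  have h1 : Real.log ‖z‖ * (b * κ / Real.log ϑ) ≤ b * (κ * (N + 1 : ℕ)) := by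
    calc _ ≤ (N + 1 : ℕ) * Real.log ϑ * (b * κ / Real.log ϑ) := by gcongr
      _ = _ := by field_simp
  have h2 := mul_le_mul_of_nonneg_left hfar.le hb0.le
  linarith
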